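/- Let $\mathcal{A}$ be an abelian category with all small limits and colimits and with enough projective and enough injective objects. For full subcategories $\mathcal{U},\mathcal{V}$ of $\mathcal{A}$ put ${}^{\perp}\mathcal{V}=\{M \mid \mathrm{Ext}^1_{\mathcal{A}}(M,V)=0 \ \forall V\in\mathcal{V}\}$ and $\mathcal{U}^{\perp}=\{M \mid \mathrm{Ext}^1_{\mathcal{A}}(U,M)=0\ \forall U\in\mathcal{U}\}$. The pair $(\mathcal{U},\mathcal{V})$ is a cotorsion pair if $\mathcal{U}={}^{\perp}\mathcal{V}$ and $\mathcal{V}=\mathcal{U}^{\perp}$; it is complete if every object $M$ has short exact sequences $0\to V\to U\to M\to 0$ and $0\to M\to V'\to U'\to 0$ with $U,U'\in\mathcal{U}$ and $V,V'\in\mathcal{V}$; it is hereditary if $\mathcal{U}$ is resolving, i.e. contains all projective objects and, for every short exact sequence $0\to S'\to S\to S''\to 0$ with $S''\in\mathcal{U}$, one has $S\in\mathcal{U}$ if and only if $S'\in\mathcal{U}$. Let $(\mathcal{X},\mathcal{Z},\mathcal{Y})$ be a complete and hereditary cotorsion triple in $\mathcal{A}$, i.e. both $(\mathcal{X},\mathcal{Z})$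 and $(\mathcal{Z},\mathcal{Y})$ are complete hereditary cotorsion pairs. The triple determines two model structures on $\mathcal{A}$. In the projective one, the trivial cofibrations are the monomorphisms with cokernel in $\mathcal{X}\cap\mathcal{Z}$ and the trivial fibrations are the epimorphisms with kernel in $\mathcal{Z}$; in the injective one, the trivial cofibrations are the monomorphisms with cokernel in $\mathcal{Z}$ and the trivial fibrations are the epimorphisms with kernel in $\mathcal{Z}\cap\mathcal{Y}$. In each of them a map is a weak equivalence if it is a trivial cofibration followed by a trivial fibration. Let $\mathrm{Ho}(\mathcal{A})$ be the category obtained from $\mathcal{A}$ by formally inverting the weak equivalences of either one of the two model structures, with canonical functor $Q:\mathcal{A}\to\mathrm{Ho}(\mathcal{A})$, and let $M,N$ be objects of $\mathcal{A}$. **Proposition 3.3.** (1) Let $i:N\to Y^N$ be any special left $\mathcal{Y}$-approximation of $N$, i.e. $Y^N\in\mathcal{Y}$ and $i$ is a monomorphism with $\mathrm{Coker}(i)\in{}^{\perp}\mathcal{Y}$. Then $Q(i)$ is an isomorphism, and $[f]\mapsto Q(i)^{-1}Q(f)$ is a well-defined bijection $$\mathrm{Hom}_{\mathcal{A}}(M,Y^N)/{\sim}\;\xrightarrow{\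 \cong\ }\;\mathrm{Hom}_{\mathrm{Ho}(\mathcal{A})}(M,N),$$ where $f\sim g$ if $g-f$ factors through an injective object. (2) Dually, let $p:X_M\to M$ be any special right $\mathcal{X}$-approximation of $M$, i.e. $X_M\in\mathcal{X}$ and $p$ is an epimorphism with $\mathrm{Ker}(p)\in\mathcal{X}^{\perp}$. Then $Q(p)$ is an isomorphism, and $[f]\mapsto Q(f)Q(p)^{-1}$ is a well-defined bijection $$\mathrm{Hom}_{\mathcal{A}}(X_M,N)/{\sim}\;\xrightarrow{\ \cong\ }\;\mathrm{Hom}_{\mathrm{Ho}(\mathcal{A})}(M,N),$$ where $f\sim g$ if $g-f$ factors through a projective object. -/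

import Mathlib

open CategoryTheory CategoryTheory.Limits

universe v u

namespace CotorsionTriple

open scoped ZeroObject

variable {A : Type u} [Category.{v} A] [Abelian A]

/-- `Ext¹(M, N) = 0`, with Mathlib's `Ext` groups. They are taken in the universe `max u v`, in which
they exist for every abelian category, so that no smallness assumption is needed. -/
def ExtOneVanishes (M N : A) : Prop :=
  haveI : HasExt.{max u v} A := HasExt.standard A
  Subsingleton (Abelian.Ext.{max u v} M N 1)

/-- `ᗮP`: the objects `M` with `Ext¹(M, N) = 0` for all `N` in `P`. -/
def extLeftPerp (P : ObjectProperty A) : ObjectProperty A :=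
  fun M => ∀ N, P N → ExtOneVanishes M N

/-- `Pᗮ`: the objects `N` with `Ext¹(M, N) = 0` for all `M` in `P`. -/
def extRightPerp (P : ObjectProperty A) : ObjectProperty A :=
  fun N => ∀ M, P M → ExtOneVanishes M N

/-- `(X, Y)` is a cotorsion pair: `X = ᗮY` and `Y = Xᗮ`. -/
structure IsCotorsionPair (X Y : ObjectProperty A) : Prop where
  left_eq : X = extLeftPerp Y
  right_eq : Y = extRightPerp X

/-- Completeness of the pair `(X, Y)`: every object `M` has short exact sequences
`0 ⟶ Y₁ ⟶ X₁ ⟶ M ⟶ 0` and `0 ⟶ M ⟶ Y₂ ⟶ X₂ ⟶ 0` with `Xᵢ` in `X` and `Yᵢ` in `Y`. -/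
structure IsCompletePair (X Y : ObjectProperty A) : Prop where
  exists_right : ∀ M : A, ∃ (Y₁ X₁ : A) (i : Y₁ ⟶ X₁) (p : X₁ ⟶ M) (w : i ≫ p = 0),
    X X₁ ∧ Y Y₁ ∧ (ShortComplex.mk i p w).ShortExact
  exists_left : ∀ M : A, ∃ (Y₂ X₂ : A) (i : M ⟶ Y₂) (p : Y₂ ⟶ X₂) (w : i ≫ p = 0),
    X X₂ ∧ Y Y₂ ∧ (ShortComplex.mk i p w).ShortExact

/-- A resolving subcategory: it contains all projective objects, and for every short exact sequence
`0 ⟶ S₁ ⟶ S₂ ⟶ S₃ ⟶ 0` with `S₃` in it, `S₂` is in it if and only if `S₁` is. -/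
structure IsResolving (X : ObjectProperty A) : Prop where
  projective_mem : ∀ P : A, Projective P → X P
  mem_iff : ∀ S : ShortComplex A, S.ShortExact → X S.X₃ → (X S.X₂ ↔ X S.X₁)

/-- `(X, Z, Y)` is a complete and hereditary cotorsion triple: each of `(X, Z)` and `(Z, Y)` is a
cotorsion pair, complete, and hereditary (its left half is resolving). -/
structure IsCompleteHereditaryCotorsionTriple (X Z Y : ObjectProperty A) : Prop where
  pair_left : IsCotorsionPair X Z
  pair_right : IsCotorsionPair Z Y
  complete_left : IsCompletePair X Z
  complete_right : IsCompletePair Z Y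
  hereditary_left : IsResolving X
  hereditary_right : IsResolving Z

/-- `i : N ⟶ YN` is a special left `Y`-approximation of `N`: `YN` is in `Y`, `i` is a monomorphism and
`Coker i` is in `ᗮY`. (Every morphism from `N` to an object of `Y` then factors through `i`, see
`IsSpecialLeftApproximation.factors`.) -/
structure IsSpecialLeftApproximation (Y : ObjectProperty A) {N YN : A} (i : N ⟶ YN) : Prop where
  mem : Y YN
  mono : Mono i
  cokernel_mem : extLeftPerp Y (cokernel i)

/-- `p : XM ⟶ M` is a special right `X`-approximation of `M`: `XM` is in `X`, `p` is an epimorphism and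
`Ker p` is in `Xᗮ`. (Every morphism from an object of `X` to `M` then factors through `p`, see
`IsSpecialRightApproximation.factors`.) -/
structure IsSpecialRightApproximation (X : ObjectProperty A) {XM M : A} (p : XM ⟶ M) : Prop where
  mem : X XM
  epi : Epi p
  kernel_mem : extRightPerp X (kernel p)

theorem IsSpecialLeftApproximation.factors {Y : ObjectProperty A} {N YN : A} {i : N ⟶ YN}
    (h : IsSpecialLeftApproximation Y i) {Y' : A} (hY' : Y Y') (f : N ⟶ Y') :
    ∃ g : YN ⟶ Y', i ≫ g = f := by
  have : HasExt.{max u v} A := HasExt.standard A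
  have := h.mono
  have hS : (ShortComplex.mk i (cokernel.π i) (cokernel.condition i)).ShortExact :=
    { exact := ShortComplex.exact_cokernel i }
  have : Subsingleton (Abelian.Ext.{max u v} (cokernel i) Y' 1) := h.cokernel_mem Y' hY'
  obtain ⟨x, hx⟩ := Abelian.Ext.contravariant_sequence_exact₁ hS Y'
    (Abelian.Ext.mk₀ f) (n₁ := 1) (by norm_num) (Subsingleton.elim _ _)
  obtain ⟨g, rfl⟩ := Abelian.Ext.mk₀_bijective _ _ |>.2 x
  refine ⟨g, (Abelian.Ext.mk₀_bijective _ _).1 ?_⟩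
  rw [← hx, Abelian.Ext.mk₀_comp_mk₀]

theorem IsSpecialRightApproximation.factors {X : ObjectProperty A} {XM M : A} {p : XM ⟶ M}
    (h : IsSpecialRightApproximation X p) {X' : A} (hX' : X X') (f : X' ⟶ M) :
    ∃ g : X' ⟶ XM, g ≫ p = f := by
  have : HasExt.{max u v} A := HasExt.standard A
  have := h.epi
  have hS : (ShortComplex.mk (kernel.ι p) p (kernel.condition p)).ShortExact :=
    { exact := ShortComplex.exact_kernel p }
  have : Subsingleton (Abelian.Ext.{max u v} X' (kernel p) 1) := h.kernel_mem X' hX'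
  obtain ⟨x, hx⟩ := Abelian.Ext.covariant_sequence_exact₃ X' hS
    (Abelian.Ext.mk₀ f) (n₁ := 1) (by norm_num) (Subsingleton.elim _ _)
  obtain ⟨g, rfl⟩ := Abelian.Ext.mk₀_bijective _ _ |>.2 x
  refine ⟨g, (Abelian.Ext.mk₀_bijective _ _).1 ?_⟩
  rw [← hx, Abelian.Ext.mk₀_comp_mk₀]

/-- In the abelian model structure with cofibrant objects `C`, trivial objects `T` and fibrant objects
`F`, the trivial cofibrations are the monomorphisms whose cokernel is trivially cofibrant. -/
def trivialCofibrations (C T : ObjectProperty A) : MorphismProperty A :=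
  fun _ _ i => Mono i ∧ C (cokernel i) ∧ T (cokernel i)

/-- In the abelian model structure with cofibrant objects `C`, trivial objects `T` and fibrant objects
`F`, the trivial fibrations are the epimorphisms whose kernel is trivially fibrant. -/
def trivialFibrations (T F : ObjectProperty A) : MorphismProperty A :=
  fun _ _ p => Epi p ∧ T (kernel p) ∧ F (kernel p)

/-- The weak equivalences of the abelian model structure with cofibrant objects `C`, trivial objects `T`
and fibrant objects `F`: the composites of a trivial cofibration followed by a trivial fibration. -/
def weakEquivalences (C T F : ObjectProperty A) : MorphismProperty A :=
  fun U V f => ∃ (E : A) (i : U ⟶ E) (p : E ⟶ V),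
    trivialCofibrations C T i ∧ trivialFibrations T F p ∧ i ≫ p = f

/-- The weak equivalences of the projective model structure determined by `(X, Z, Y)`: the cofibrant
objects are `X`, every object is fibrant, the trivial objects are `Z`. -/
def projectiveWeakEquivalences (X Z : ObjectProperty A) : MorphismProperty A :=
  weakEquivalences X Z ⊤

/-- The weak equivalences of the injective model structure determined by `(X, Z, Y)`: every object is
cofibrant, the fibrant objects are `Y`, the trivial objects are `Z`. -/
def injectiveWeakEquivalences (Z Y : ObjectProperty A) : MorphismProperty A :=
  weakEquivalences ⊤ Z Y

/-- Morphisms `f, g : M ⟶ N` are equivalent if `g - f` factors through an injective object. -/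
def injectiveStableSetoid (M N : A) : Setoid (M ⟶ N) where
  r f g := ∃ (I : A) (a : M ⟶ I) (b : I ⟶ N), Injective I ∧ a ≫ b = g - f
  iseqv :=
    { refl := fun f => ⟨(0 : A), 0, 0, inferInstance, by simp⟩
      symm := by
        rintro f g ⟨I, a, b, hI, h⟩
        exact ⟨I, a, -b, hI, by simp [h]⟩
      trans := by
        rintro f g k ⟨I, a, b, hI, h⟩ ⟨J, c, d, hJ, h'⟩
        exact ⟨I ⊞ J, biprod.lift a c, biprod.desc b d, inferInstance, by simp [h, h']⟩ }

/-- Morphisms `f, g : M ⟶ N` are equivalent if `g - f` factors through a projective object. -/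
def projectiveStableSetoid (M N : A) : Setoid (M ⟶ N) where
  r f g := ∃ (P : A) (a : M ⟶ P) (b : P ⟶ N), Projective P ∧ a ≫ b = g - f
  iseqv :=
    { refl := fun f => ⟨(0 : A), 0, 0, inferInstance, by simp⟩
      symm := by
        rintro f g ⟨I, a, b, hI, h⟩
        exact ⟨I, a, -b, hI, by simp [h]⟩
      trans := by
        rintro f g k ⟨I, a, b, hI, h⟩ ⟨J, c, d, hJ, h'⟩
        exact ⟨I ⊞ J, biprod.lift a c, biprod.desc b d, inferInstance, by simp [h, h']⟩ }

end CotorsionTriple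

/-! In both model structures the weak equivalences include all monomorphisms with cokernel in `Z`
and all epimorphisms with kernel in `Z`, and each weak equivalence is one of the former followed by
one of the latter. The argument uses nothing else about `W`, so it treats both at once. Since `ᗮY =
Z = Xᗮ`, special approximations are inverted, and it remains to compute maps into an object of `Y`,
dually out of an object of `X`.

For `N` in `Y`, the presheaf `Hom(-, N)` modulo injectives inverts `W`: maps to `N` extend along
monomorphisms with cokernel in `Z` because `Ext¹(Z, Y) = 0`, uniquely up to injectives because maps
from `Z` to `Y` factor through `Z ∩ Y`, which consists of injectives (`exists_factor_injective`).
Epimorphisms reduce to monomorphisms by adding an injective summand (`exists_biprod_lift`). This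
rests on `Z` being closed under kernels of epimorphisms and cokernels of monomorphisms
(`mem_syzygy`, `mem_cosyzygy`). A Yoneda argument (`exists_equiv_localization_hom_of_precomp`) then
yields the bijection, without calculus of fractions. -/

namespace CotorsionTriple

/-! ### Morphisms in a localization, up to an equivalence relation -/

section Localization

variable {C : Type u} [Category.{v} C] (W : MorphismProperty C)

/-- If the presheaf of morphisms to `Y` modulo `s` inverts `W`, and `s`-equivalent morphisms become
equal after localization, then it computes the morphisms to `Y` in the localized category. -/
theorem exists_equiv_localization_hom_of_precomp {Y : C} (s : ∀ M : C, Setoid (M ⟶ Y))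
    (comp : ∀ ⦃M M' : C⦄ (f : M ⟶ M') (g g' : M' ⟶ Y), s M' g g' → s M (f ≫ g) (f ≫ g'))
    (surj : ∀ ⦃M M' : C⦄ (w : M ⟶ M'), W w → ∀ f : M ⟶ Y, ∃ g : M' ⟶ Y, s M (w ≫ g) f)
    (inj : ∀ ⦃M M' : C⦄ (w : M ⟶ M'), W w →
      ∀ g g' : M' ⟶ Y, s M (w ≫ g) (w ≫ g') → s M' g g')
    (map_eq : ∀ ⦃M : C⦄ (g g' : M ⟶ Y), s M g g' → W.Q.map g = W.Q.map g') (M : C) :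
    ∃ e : Quotient (s M) ≃ (W.Q.obj M ⟶ W.Q.obj Y),
      ∀ f : M ⟶ Y, e (Quotient.mk _ f) = W.Q.map f := by
  -- The presheaf is written as a covariant functor so that it factors through the localization.
  let F : C ⥤ (Type v)ᵒᵖ :=
    { obj M := Opposite.op (Quotient (s M))
      map f := (↾(Quotient.map (f ≫ ·) (comp f))).op
      map_id M := by
        apply Quiver.Hom.unop_inj
        ext x
        induction x using Quotient.inductionOn
        simp
      map_comp f g := by
        apply Quiver.Hom.unop_inj
        ext x
        induction x using Quotient.inductionOn
        simp }
  have hF : W.IsInvertedBy F := fun M M' w hw => by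
    have : IsIso (↾(Quotient.map (w ≫ ·) (comp w))) := by
      rw [isIso_iff_bijective]
      refine ⟨fun x y => ?_, fun x => ?_⟩
      · induction x, y using Quotient.inductionOn₂ with | h g g' =>
        exact fun hgg' => Quotient.sound (inj w hw _ _ (Quotient.exact hgg'))
      · induction x using Quotient.inductionOn with | h f =>
        obtain ⟨g, hg⟩ := surj w hw f
        exact ⟨Quotient.mk _ g, Quotient.sound hg⟩
    exact inferInstanceAs (IsIso (↾(Quotient.map (w ≫ ·) (comp w))).op)
  -- Surjectivity: `P` contains the images of morphisms and the inverses of `W` and is stable under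
  -- composition, so it always holds; evaluate it at `𝟙 Y`.
  let P : MorphismProperty W.Localization := fun U V φ =>
    ∀ f : V.as.obj ⟶ Y, ∃ f' : U.as.obj ⟶ Y, W.Q.map f' = φ ≫ W.Q.map f
  have : P.IsStableUnderComposition :=
    ⟨fun φ ψ hφ hψ f => by
      obtain ⟨f', hf'⟩ := hψ f
      obtain ⟨f'', hf''⟩ := hφ f'
      exact ⟨f'', hf''.trans ((congrArg (φ ≫ ·) hf').trans (Category.assoc φ ψ _).symm)⟩⟩
  have hP : P = ⊤ := Localization.Construction.morphismProperty_eq_top P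
    (fun _ _ g f => ⟨g ≫ f, W.Q.map_comp g f⟩) (fun M M' w hw (f : M ⟶ Y) => by
      obtain ⟨g, hg⟩ := surj w hw f
      have h : W.Q.map g = (Localization.Construction.wIso w hw).inv ≫ W.Q.map f := by
        rw [Iso.eq_inv_comp]
        exact (W.Q.map_comp w g).symm.trans (map_eq _ _ hg)
      exact ⟨g, h⟩)
  refine ⟨Equiv.ofBijective (Quotient.lift (fun f => W.Q.map f) (map_eq (M := M))) ⟨?_, ?_⟩,
    fun _ => rfl⟩
  · intro x y hxy
    induction x, y using Quotient.inductionOn₂ with | h f g =>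
    -- Yoneda: `F` also equalizes `f` and `g`, and the class of `𝟙 Y` recovers theirs.
    have h : AreEqualizedByLocalization W f g := hxy
    have h' := congrArg Quiver.Hom.unop (h.map_eq_of_isInvertedBy F hF)
    have h'' := ConcreteCategory.congr_hom h' (Quotient.mk (s Y) (𝟙 Y))
    have hf : Quotient.mk (s M) (f ≫ 𝟙 Y) = Quotient.mk (s M) (g ≫ 𝟙 Y) := h''
    simpa using hf
  · intro φ
    have : P φ := hP ▸ MorphismProperty.top_apply φ
    obtain ⟨f, hf⟩ := this (𝟙 Y)
    exact ⟨Quotient.mk _ f, hf.trans ((congrArg _ (W.Q.map_id Y)).trans (Category.comp_id φ))⟩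

/-- If the functor of morphisms from `X` modulo `s` inverts `W`, and `s`-equivalent morphisms become
equal after localization, then it computes the morphisms from `X` in the localized category. -/
theorem exists_equiv_localization_hom_of_postcomp {X : C} (s : ∀ M : C, Setoid (X ⟶ M))
    (comp : ∀ ⦃M M' : C⦄ (f : M ⟶ M') (g g' : X ⟶ M), s M g g' → s M' (g ≫ f) (g' ≫ f))
    (surj : ∀ ⦃M M' : C⦄ (w : M ⟶ M'), W w → ∀ f : X ⟶ M', ∃ g : X ⟶ M, s M' (g ≫ w) f)
    (inj : ∀ ⦃M M' : C⦄ (w : M ⟶ M'), W w →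
      ∀ g g' : X ⟶ M, s M' (g ≫ w) (g' ≫ w) → s M g g')
    (map_eq : ∀ ⦃M : C⦄ (g g' : X ⟶ M), s M g g' → W.Q.map g = W.Q.map g') (M : C) :
    ∃ e : Quotient (s M) ≃ (W.Q.obj X ⟶ W.Q.obj M),
      ∀ f : X ⟶ M, e (Quotient.mk _ f) = W.Q.map f := by
  let F : C ⥤ Type v :=
    { obj M := Quotient (s M)
      map f := ↾(Quotient.map (· ≫ f) (comp f))
      map_id M := by
        ext x
        induction x using Quotient.inductionOn
        simp
      map_comp f g := by
        ext x
        induction x using Quotient.inductionOn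
        simp }
  have hF : W.IsInvertedBy F := fun M M' w hw => by
    rw [isIso_iff_bijective]
    refine ⟨fun x y => ?_, fun x => ?_⟩
    · induction x, y using Quotient.inductionOn₂ with | h g g' =>
      exact fun hgg' => Quotient.sound (inj w hw _ _ (Quotient.exact hgg'))
    · induction x using Quotient.inductionOn with | h f =>
      obtain ⟨g, hg⟩ := surj w hw f
      exact ⟨Quotient.mk _ g, Quotient.sound hg⟩
  let P : MorphismProperty W.Localization := fun U V φ =>
    ∀ f : X ⟶ U.as.obj, ∃ f' : X ⟶ V.as.obj, W.Q.map f' = W.Q.map f ≫ φ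
  have : P.IsStableUnderComposition :=
    ⟨fun φ ψ hφ hψ f => by
      obtain ⟨f', hf'⟩ := hφ f
      obtain ⟨f'', hf''⟩ := hψ f'
      exact ⟨f'', hf''.trans ((congrArg (· ≫ ψ) hf').trans (Category.assoc _ φ ψ))⟩⟩
  have hP : P = ⊤ := Localization.Construction.morphismProperty_eq_top P
    (fun _ _ g f => ⟨f ≫ g, W.Q.map_comp f g⟩) (fun M M' w hw (f : X ⟶ M') => by
      obtain ⟨g, hg⟩ := surj w hw f
      have h : W.Q.map g = W.Q.map f ≫ (Localization.Construction.wIso w hw).inv := by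
        rw [Iso.eq_comp_inv]
        exact (W.Q.map_comp g w).symm.trans (map_eq _ _ hg)
      exact ⟨g, h⟩)
  refine ⟨Equiv.ofBijective (Quotient.lift (fun f => W.Q.map f) (map_eq (M := M))) ⟨?_, ?_⟩,
    fun _ => rfl⟩
  · intro x y hxy
    induction x, y using Quotient.inductionOn₂ with | h f g =>
    have h : AreEqualizedByLocalization W f g := hxy
    have h' := ConcreteCategory.congr_hom (h.map_eq_of_isInvertedBy F hF)
      (Quotient.mk (s X) (𝟙 X))
    have hf : Quotient.mk (s M) (𝟙 X ≫ f) = Quotient.mk (s M) (𝟙 X ≫ g) := h'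
    simpa using hf
  · intro φ
    have : P φ := hP ▸ MorphismProperty.top_apply φ
    obtain ⟨f, hf⟩ := this (𝟙 X)
    exact ⟨Quotient.mk _ f, hf.trans ((congrArg (· ≫ φ) (W.Q.map_id X)).trans (Category.id_comp φ))⟩

end Localization

open scoped ZeroObject

variable {A : Type u} [Category.{v} A] [Abelian A]

/-! ### Vanishing of `Ext¹` and short exact sequences -/

/-- The obstruction to extending `f` is its image under the connecting map to `Ext¹(S.X₃, Y)`. -/
theorem ExtOneVanishes.exists_extension {S : ShortComplex A} (hS : S.ShortExact) {Y : A}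
    (h : ExtOneVanishes S.X₃ Y) (f : S.X₁ ⟶ Y) : ∃ g : S.X₂ ⟶ Y, S.f ≫ g = f := by
  have : HasExt.{max u v} A := HasExt.standard A
  have : Subsingleton (Abelian.Ext.{max u v} S.X₃ Y 1) := h
  obtain ⟨x, hx⟩ := Abelian.Ext.contravariant_sequence_exact₁ hS Y
    (Abelian.Ext.mk₀ f) (n₁ := 1) (by norm_num) (Subsingleton.elim _ _)
  obtain ⟨g, rfl⟩ := (Abelian.Ext.mk₀_bijective _ _).2 x
  refine ⟨g, (Abelian.Ext.mk₀_bijective _ _).1 ?_⟩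
  rw [← hx, Abelian.Ext.mk₀_comp_mk₀]

theorem ExtOneVanishes.exists_lift {S : ShortComplex A} (hS : S.ShortExact) {X : A}
    (h : ExtOneVanishes X S.X₁) (f : X ⟶ S.X₃) : ∃ g : X ⟶ S.X₂, g ≫ S.g = f := by
  have : HasExt.{max u v} A := HasExt.standard A
  have : Subsingleton (Abelian.Ext.{max u v} X S.X₁ 1) := h
  obtain ⟨x, hx⟩ := Abelian.Ext.covariant_sequence_exact₃ X hS
    (Abelian.Ext.mk₀ f) (n₁ := 1) (by norm_num) (Subsingleton.elim _ _)
  obtain ⟨g, rfl⟩ := (Abelian.Ext.mk₀_bijective _ _).2 x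
  refine ⟨g, (Abelian.Ext.mk₀_bijective _ _).1 ?_⟩
  rw [← hx, Abelian.Ext.mk₀_comp_mk₀]

theorem ExtOneVanishes.of_injective (M I : A) [Injective I] : ExtOneVanishes M I := by
  have : HasExt.{max u v} A := HasExt.standard A
  exact Abelian.Ext.subsingleton_of_injective M I 0

theorem ExtOneVanishes.middle {S : ShortComplex A} (hS : S.ShortExact) {M : A}
    (h₁ : ExtOneVanishes M S.X₁) (h₃ : ExtOneVanishes M S.X₃) : ExtOneVanishes M S.X₂ := by
  have : HasExt.{max u v} A := HasExt.standard A
  have : Subsingleton (Abelian.Ext.{max u v} M S.X₁ 1) := h₁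
  have : Subsingleton (Abelian.Ext.{max u v} M S.X₃ 1) := h₃
  refine subsingleton_of_forall_eq (α := Abelian.Ext.{max u v} M S.X₂ 1) 0 fun x => ?_
  obtain ⟨y, rfl⟩ := Abelian.Ext.covariant_sequence_exact₂ M hS x (Subsingleton.elim _ _)
  rw [Subsingleton.elim y 0, Abelian.Ext.zero_comp]

/-- Dimension shifting: `Ext¹(M, S.X₃)` vanishes if `Ext¹(M, S.X₂)` and `Ext¹(T.X₁, S.X₁)` do, for `T`
a short exact sequence ending in `M` whose middle term is projective. -/
theorem ExtOneVanishes.right_of_syzygy {S T : ShortComplex A} (hS : S.ShortExact)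
    (hT : T.ShortExact) [Projective T.X₂] (h₂ : ExtOneVanishes T.X₃ S.X₂)
    (h₁ : ExtOneVanishes T.X₁ S.X₁) : ExtOneVanishes T.X₃ S.X₃ := by
  have : HasExt.{max u v} A := HasExt.standard A
  have : Subsingleton (Abelian.Ext.{max u v} T.X₃ S.X₂ 1) := h₂
  have : Subsingleton (Abelian.Ext.{max u v} T.X₁ S.X₁ 1) := h₁
  -- `Ext²(T.X₂, -) = 0`, so this group is a quotient of `Ext¹(T.X₁, S.X₁)`.
  have : Subsingleton (Abelian.Ext.{max u v} T.X₃ S.X₁ 2) := by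
    refine subsingleton_of_forall_eq 0 fun x => ?_
    obtain ⟨y, rfl⟩ := Abelian.Ext.contravariant_sequence_exact₃ hT S.X₁ x
      (Abelian.Ext.eq_zero_of_projective _) (n₀ := 1) (by norm_num)
    rw [Subsingleton.elim y 0, Abelian.Ext.comp_zero]
  refine subsingleton_of_forall_eq (α := Abelian.Ext.{max u v} T.X₃ S.X₃ 1) 0 fun x => ?_
  obtain ⟨y, rfl⟩ := Abelian.Ext.covariant_sequence_exact₃ T.X₃ hS x (n₁ := 2) (by norm_num)
    (Subsingleton.elim _ _)
  rw [Subsingleton.elim y 0, Abelian.Ext.zero_comp]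

theorem shortExact_kernel {M N : A} (p : M ⟶ N) [Epi p] :
    (ShortComplex.mk (kernel.ι p) p (kernel.condition p)).ShortExact where
  exact := ShortComplex.exact_kernel p

theorem shortExact_cokernel {M N : A} (i : M ⟶ N) [Mono i] :
    (ShortComplex.mk i (cokernel.π i) (cokernel.condition i)).ShortExact where
  exact := ShortComplex.exact_cokernel i

theorem IsResolving.zero_mem {X : ObjectProperty A} (hX : IsResolving X) {M : A} (hM : IsZero M) :
    X M :=
  hX.projective_mem M hM.projective

/-- An isomorphism is a short exact sequence with third term zero, and zero is projective. -/
theorem IsResolving.of_iso {X : ObjectProperty A} (hX : IsResolving X) {M N : A} (e : M ≅ N)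
    (hM : X M) : X N := by
  have : (ShortComplex.mk e.hom (0 : N ⟶ (0 : A)) (by simp)).ShortExact :=
    { exact := (ShortComplex.exact_iff_epi _ rfl).2 (inferInstanceAs (Epi e.hom))
      mono_f := inferInstanceAs (Mono e.hom)
      epi_g := ⟨fun _ _ _ => (isZero_zero A).eq_of_src _ _⟩ }
  exact (hX.mem_iff _ this (hX.zero_mem (isZero_zero A))).2 hM

/-! ### The factorizations -/

/-! ### Monomorphisms made epimorphisms by adding a summand to the source -/

section

variable {M N P : A} (i : M ⟶ N) (s : P ⟶ N)

theorem epi_biprod_desc [Epi (s ≫ cokernel.π i)] : Epi (biprod.desc i s) := by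
  refine Preadditive.epi_of_cancel_zero _ fun t ht => ?_
  have h₁ : i ≫ t = 0 := by simpa using biprod.inl ≫= ht
  have h₂ : s ≫ t = 0 := by simpa using biprod.inr ≫= ht
  have h₃ : cokernel.desc i t h₁ = 0 := by
    rw [← cancel_epi (s ≫ cokernel.π i), Category.assoc, cokernel.π_desc, h₂, comp_zero]
  rw [← cokernel.π_desc i t h₁, h₃, comp_zero]

theorem kernel_biprod_desc_condition :
    (kernel.ι (biprod.desc i s) ≫ biprod.fst) ≫ i +
      (kernel.ι (biprod.desc i s) ≫ biprod.snd) ≫ s = 0 := by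
  rw [Category.assoc, Category.assoc, ← Preadditive.comp_add, ← biprod.desc_eq, kernel.condition]

theorem kernel_biprod_desc_snd_comp :
    (kernel.ι (biprod.desc i s) ≫ biprod.snd) ≫ s ≫ cokernel.π i = 0 := by
  simpa using kernel_biprod_desc_condition i s =≫ cokernel.π i

/-- The kernel of `M ⊞ P ⟶ N` is a syzygy of the cokernel of `M ⟶ N`. -/
theorem shortExact_kernel_biprod_desc [Mono i] [Epi (s ≫ cokernel.π i)] :
    (ShortComplex.mk (kernel.ι (biprod.desc i s) ≫ biprod.snd) (s ≫ cokernel.π i)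
      (kernel_biprod_desc_snd_comp i s)).ShortExact := by
  have : Mono (kernel.ι (biprod.desc i s) ≫ biprod.snd) := by
    refine Preadditive.mono_of_cancel_zero _ fun t ht => ?_
    have h := t ≫= kernel_biprod_desc_condition i s
    rw [Preadditive.comp_add, ← Category.assoc t _ s, ht, zero_comp, add_zero, comp_zero,
      ← Category.assoc] at h
    have h₁ := zero_of_comp_mono i h
    rw [← cancel_mono (kernel.ι (biprod.desc i s)), zero_comp]
    exact biprod.hom_ext _ _ (by simpa using h₁) (by simpa using ht)
  refine { exact := ShortComplex.exact_of_f_is_kernel _ (KernelFork.IsLimit.ofι' _ _ ?_) }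
  intro T t ht
  have hi := (shortExact_cokernel i).fIsKernel
  obtain ⟨u, hu⟩ := KernelFork.IsLimit.lift' hi (t ≫ s) (by simpa using ht)
  replace hu : u ≫ i = t ≫ s := hu
  -- The sign makes the two contributions in `N` cancel.
  exact ⟨kernel.lift _ (biprod.lift (-u) t) (by simp [biprod.lift_desc, hu]), by simp⟩

end

/-! ### Epimorphisms made monomorphisms by adding a summand to the target -/

section

variable {M N I : A} (p : M ⟶ N) (e : M ⟶ I)

theorem mono_biprod_lift [Mono (kernel.ι p ≫ e)] : Mono (biprod.lift p e) := by
  refine Preadditive.mono_of_cancel_zero _ fun t ht => ?_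
  have h₁ : t ≫ p = 0 := by simpa using ht =≫ biprod.fst
  have h₂ : t ≫ e = 0 := by simpa using ht =≫ biprod.snd
  have h₃ : kernel.lift p t h₁ = 0 := by
    rw [← cancel_mono (kernel.ι p ≫ e), kernel.lift_ι_assoc, h₂, zero_comp]
  rw [← kernel.lift_ι p t h₁, h₃, zero_comp]

theorem cokernel_biprod_lift_condition :
    p ≫ biprod.inl ≫ cokernel.π (biprod.lift p e) +
      e ≫ biprod.inr ≫ cokernel.π (biprod.lift p e) = 0 := by
  rw [← Category.assoc, ← Category.assoc, ← Preadditive.add_comp, ← biprod.lift_eq,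
    cokernel.condition]

theorem kernel_comp_inr_cokernel_biprod_lift :
    (kernel.ι p ≫ e) ≫ biprod.inr ≫ cokernel.π (biprod.lift p e) = 0 := by
  simpa using kernel.ι p ≫= cokernel_biprod_lift_condition p e

/-- The cokernel of `M ⟶ N ⊞ I` is a cosyzygy of the kernel of `M ⟶ N`. -/
theorem shortExact_cokernel_biprod_lift [Epi p] [Mono (kernel.ι p ≫ e)] :
    (ShortComplex.mk (kernel.ι p ≫ e) (biprod.inr ≫ cokernel.π (biprod.lift p e))
      (kernel_comp_inr_cokernel_biprod_lift p e)).ShortExact := by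
  have : Epi (biprod.inr ≫ cokernel.π (biprod.lift p e)) := by
    refine Preadditive.epi_of_cancel_zero _ fun t ht => ?_
    have h := cokernel_biprod_lift_condition p e =≫ t
    rw [Preadditive.add_comp, Category.assoc, Category.assoc, Category.assoc, Category.assoc,
      ← Category.assoc biprod.inr, ht, comp_zero, add_zero, zero_comp] at h
    have h₁ := zero_of_epi_comp p h
    rw [← cancel_epi (cokernel.π (biprod.lift p e)), comp_zero]
    exact biprod.hom_ext' _ _ (by simpa using h₁) (by simpa using ht)
  refine { exact := ShortComplex.exact_of_g_is_cokernel _ (CokernelCofork.IsColimit.ofπ' _ _ ?_) }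
  intro T t ht
  have hp := (shortExact_kernel p).gIsCokernel
  obtain ⟨u, hu⟩ := CokernelCofork.IsColimit.desc' hp (e ≫ t) (by simpa using ht)
  replace hu : p ≫ u = e ≫ t := hu
  exact ⟨cokernel.desc _ (biprod.desc (-u) t) (by simp [biprod.lift_desc, hu]), by simp⟩

end


/-! ### Consequences of the axioms of a cotorsion triple -/

namespace IsCompleteHereditaryCotorsionTriple

variable {X Z Y : ObjectProperty A} (h : IsCompleteHereditaryCotorsionTriple X Z Y)

include h

theorem ext_left {M N : A} (hM : X M) (hN : Z N) : ExtOneVanishes M N := by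
  rw [h.pair_left.left_eq] at hM
  exact hM N hN

theorem ext_right {M N : A} (hM : Z M) (hN : Y N) : ExtOneVanishes M N := by
  rw [h.pair_right.left_eq] at hM
  exact hM N hN

theorem mem_of_projective (P : A) [Projective P] : Z P :=
  h.hereditary_right.projective_mem P inferInstance

theorem mem_of_injective (I : A) [Injective I] : Z I := by
  rw [h.pair_left.right_eq]
  exact fun M _ => ExtOneVanishes.of_injective M I

theorem mem_syzygy {S : ShortComplex A} (hS : S.ShortExact) (h₂ : Z S.X₂) (h₃ : Z S.X₃) :
    Z S.X₁ :=
  (h.hereditary_right.mem_iff S hS h₃).1 h₂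

/-- Heredity of `X` enters here: it puts the syzygy of `M` in `X`, so that dimension shifting
applies. -/
theorem mem_cosyzygy [EnoughProjectives A] {S : ShortComplex A} (hS : S.ShortExact)
    (h₁ : Z S.X₁) (h₂ : Z S.X₂) : Z S.X₃ := by
  rw [h.pair_left.right_eq]
  intro M hM
  have hT := shortExact_kernel (Projective.π M)
  refine ExtOneVanishes.right_of_syzygy hS hT (h.ext_left hM h₂) (h.ext_left ?_ h₁)
  exact (h.hereditary_left.mem_iff _ hT hM).1 (h.hereditary_left.projective_mem _ inferInstance)

/-- The kernel of a projective cover `Projective.over P ⟶ P` lies in `Z`, so the epimorphism splits.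
-/
theorem projective_of_mem [EnoughProjectives A] {P : A} (hX : X P) (hZ : Z P) : Projective P := by
  have hS := shortExact_kernel (Projective.π P)
  obtain ⟨s, hs⟩ := ExtOneVanishes.exists_lift hS
    (h.ext_left hX (h.mem_syzygy hS (h.mem_of_projective _) hZ)) (𝟙 P)
  exact Retract.projective ⟨s, Projective.π P, hs⟩

theorem injective_of_mem [EnoughProjectives A] [EnoughInjectives A] {I : A}
    (hZ : Z I) (hY : Y I) : Injective I := by
  have hS := shortExact_cokernel (Injective.ι I)
  obtain ⟨r, hr⟩ := ExtOneVanishes.exists_extension hS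
    (h.ext_right (h.mem_cosyzygy hS hZ (h.mem_of_injective _)) hY) (𝟙 I)
  exact Retract.injective ⟨Injective.ι I, r, hr⟩

theorem exists_factor_injective [EnoughProjectives A] [EnoughInjectives A] {M N : A}
    (hM : Z M) (hN : Y N) (f : M ⟶ N) :
    ∃ (I : A) (a : M ⟶ I) (b : I ⟶ N), Injective I ∧ a ≫ b = f := by
  -- `I` is in `Z` by choice and in `Y` as an extension of `N` by `K`, hence injective.
  obtain ⟨K, I, i, p, w, hI, hK, hS⟩ := h.complete_right.exists_right N
  have hI' : Y I := by
    rw [h.pair_right.right_eq]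
    exact fun L hL => ExtOneVanishes.middle hS (h.ext_right hL hK) (h.ext_right hL hN)
  obtain ⟨a, ha⟩ := ExtOneVanishes.exists_lift hS (h.ext_right hM hK) f
  exact ⟨I, a, p, h.injective_of_mem hI hI', ha⟩

theorem exists_factor_projective [EnoughProjectives A] {M N : A}
    (hM : X M) (hN : Z N) (f : M ⟶ N) :
    ∃ (P : A) (a : M ⟶ P) (b : P ⟶ N), Projective P ∧ a ≫ b = f := by
  obtain ⟨P, L, i, p, w, hL, hP, hS⟩ := h.complete_left.exists_left M
  obtain ⟨b, hb⟩ := ExtOneVanishes.exists_extension hS (h.ext_left hL hN) f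
  exact ⟨P, i, b, h.projective_of_mem ((h.hereditary_left.mem_iff _ hS hL).2 hM) hP, hb⟩

end IsCompleteHereditaryCotorsionTriple

/-! ### Thick monomorphisms and epimorphisms -/

/-- The monomorphisms with cokernel in `Z`. -/
def monosWithCokernel (Z : ObjectProperty A) : MorphismProperty A :=
  fun _ _ i => Mono i ∧ Z (cokernel i)

/-- The epimorphisms with kernel in `Z`. -/
def episWithKernel (Z : ObjectProperty A) : MorphismProperty A :=
  fun _ _ p => Epi p ∧ Z (kernel p)

theorem exists_monosWithCokernel_of_weakEquivalences {C Z F : ObjectProperty A} {M N : A}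
    {f : M ⟶ N} (hf : weakEquivalences C Z F f) :
    ∃ (E : A) (i : M ⟶ E) (p : E ⟶ N), monosWithCokernel Z i ∧ episWithKernel Z p ∧ i ≫ p = f := by
  obtain ⟨E, i, p, ⟨hi, _, hi'⟩, ⟨hp, hp', _⟩, rfl⟩ := hf
  exact ⟨E, i, p, ⟨hi, hi'⟩, ⟨hp, hp'⟩, rfl⟩

/-- The cokernel of the inclusion of a direct summand is the complement. -/
noncomputable def cokernelBiprodInlIso (M P : A) : P ≅ cokernel (biprod.inl : M ⟶ M ⊞ P) :=
  (biprod.isCokernelInlCokernelFork M P).coconePointUniqueUpToIso (colimit.isColimit _)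

/-- The kernel of the projection onto a direct summand is the complement. -/
noncomputable def kernelBiprodFstIso (M I : A) : I ≅ kernel (biprod.fst : M ⊞ I ⟶ M) :=
  (biprod.isKernelFstKernelFork M I).conePointUniqueUpToIso (limit.isLimit _)

namespace IsCompleteHereditaryCotorsionTriple

variable {X Z Y : ObjectProperty A} (h : IsCompleteHereditaryCotorsionTriple X Z Y)

include h

/-- A monomorphism with cokernel in `Z` is the inclusion of a direct summand with projective
complement, followed by an epimorphism with kernel in `Z`. -/
theorem exists_biprod_desc [EnoughProjectives A] {M N : A} {i : M ⟶ N}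
    (hi : monosWithCokernel Z i) :
    ∃ (P : A) (s : P ⟶ N), Projective P ∧ episWithKernel Z (biprod.desc i s) := by
  have := hi.1
  let s := Projective.factorThru (Projective.π (cokernel i)) (cokernel.π i)
  have : Epi (s ≫ cokernel.π i) := by
    rw [Projective.factorThru_comp]
    infer_instance
  exact ⟨_, s, inferInstance, epi_biprod_desc i s,
    h.mem_syzygy (shortExact_kernel_biprod_desc i s) (h.mem_of_projective _) hi.2⟩

/-- An epimorphism with kernel in `Z` is a monomorphism with cokernel in `Z`, followed by the
projection onto a direct summand with injective complement. -/
theorem exists_biprod_lift [EnoughProjectives A] [EnoughInjectives A] {M N : A} {p : M ⟶ N}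
    (hp : episWithKernel Z p) :
    ∃ (I : A) (e : M ⟶ I), Injective I ∧ monosWithCokernel Z (biprod.lift p e) := by
  have := hp.1
  let e := Injective.factorThru (Injective.ι (kernel p)) (kernel.ι p)
  have : Mono (kernel.ι p ≫ e) := by
    rw [Injective.comp_factorThru]
    infer_instance
  exact ⟨_, e, inferInstance, mono_biprod_lift p e,
    h.mem_cosyzygy (shortExact_cokernel_biprod_lift p e) hp.2 (h.mem_of_injective _)⟩

theorem zero_mem {M : A} (hM : IsZero M) : Z M := h.hereditary_right.zero_mem hM

theorem monosWithCokernel_inl (M : A) {P : A} (hP : Z P) :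
    monosWithCokernel Z (biprod.inl : M ⟶ M ⊞ P) :=
  ⟨inferInstance, h.hereditary_right.of_iso (cokernelBiprodInlIso M P) hP⟩

theorem projectiveWeakEquivalences_of_epi {M N : A} {p : M ⟶ N} (hp : episWithKernel Z p) :
    projectiveWeakEquivalences X Z p := by
  have h₀ : IsZero (cokernel (𝟙 M)) := isZero_cokernel_of_epi _
  exact ⟨M, 𝟙 M, p, ⟨inferInstance, h.hereditary_left.zero_mem h₀, h.zero_mem h₀⟩,
    ⟨hp.1, hp.2, trivial⟩, Category.id_comp p⟩

/-- The cokernel of `i` need not lie in `X`, but that of the inclusion into `M ⊞ P` is projective,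
hence in `X ∩ Z`. -/
theorem projectiveWeakEquivalences_of_mono [EnoughProjectives A] {M N : A} {i : M ⟶ N}
    (hi : monosWithCokernel Z i) : projectiveWeakEquivalences X Z i := by
  obtain ⟨P, s, hP, hs⟩ := h.exists_biprod_desc hi
  exact ⟨M ⊞ P, biprod.inl, biprod.desc i s,
    ⟨inferInstance, h.hereditary_left.projective_mem _ (hP.of_iso (cokernelBiprodInlIso M P)),
      (h.monosWithCokernel_inl M (h.mem_of_projective P)).2⟩,
    ⟨hs.1, hs.2, trivial⟩, biprod.inl_desc _ _⟩

theorem mem_right_of_injective (I : A) [Injective I] : Y I := by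
  rw [h.pair_right.right_eq]
  exact fun M _ => ExtOneVanishes.of_injective M I

theorem injectiveWeakEquivalences_of_mono {M N : A} {i : M ⟶ N} (hi : monosWithCokernel Z i) :
    injectiveWeakEquivalences Z Y i := by
  have h₀ : IsZero (kernel (𝟙 N)) := isZero_kernel_of_mono _
  have := h₀.injective
  exact ⟨N, i, 𝟙 N, ⟨hi.1, trivial, hi.2⟩,
    ⟨inferInstance, h.zero_mem h₀, h.mem_right_of_injective _⟩, Category.comp_id i⟩

theorem injectiveWeakEquivalences_of_epi [EnoughProjectives A] [EnoughInjectives A] {M N : A}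
    {p : M ⟶ N} (hp : episWithKernel Z p) : injectiveWeakEquivalences Z Y p := by
  obtain ⟨I, e, hI, he⟩ := h.exists_biprod_lift hp
  have : Injective (kernel (biprod.fst : N ⊞ I ⟶ N)) := hI.of_iso (kernelBiprodFstIso N I)
  exact ⟨N ⊞ I, biprod.lift p e, biprod.fst, ⟨he.1, trivial, he.2⟩,
    ⟨inferInstance, h.mem_of_injective _, h.mem_right_of_injective _⟩, biprod.lift_fst _ _⟩

end IsCompleteHereditaryCotorsionTriple

/-! ### Stable morphisms -/

theorem injectiveStableSetoid_comp {M M' N : A} (f : M ⟶ M') (g g' : M' ⟶ N)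
    (hg : injectiveStableSetoid M' N g g') : injectiveStableSetoid M N (f ≫ g) (f ≫ g') := by
  obtain ⟨I, a, b, hI, hab⟩ := hg
  exact ⟨I, f ≫ a, b, hI, by rw [Category.assoc, hab, Preadditive.comp_sub]⟩

theorem projectiveStableSetoid_comp {M N N' : A} (f : N ⟶ N') (g g' : M ⟶ N)
    (hg : projectiveStableSetoid M N g g') : projectiveStableSetoid M N' (g ≫ f) (g' ≫ f) := by
  obtain ⟨P, a, b, hP, hab⟩ := hg
  exact ⟨P, a, b ≫ f, hP, by rw [← Category.assoc, hab, Preadditive.sub_comp]⟩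

/-- A functor inverting the inclusion of `N` into `N ⊞ K` identifies morphisms to `N` whose difference
factors through `K`. -/
theorem map_eq_of_sub_factors {D : Type*} [Category* D] (F : A ⥤ D)
    {M N K : A} (hK : IsIso (F.map (biprod.inl : N ⟶ N ⊞ K))) {f g : M ⟶ N}
    (a : M ⟶ K) (b : K ⟶ N) (hab : a ≫ b = g - f) : F.map f = F.map g := by
  -- Both are retractions of the inverted inclusion; `f` and `g` are their composites with
  -- `biprod.lift f a`.
  have hd : F.map (biprod.desc (𝟙 N) (0 : K ⟶ N)) = F.map (biprod.desc (𝟙 N) b) := by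
    rw [← cancel_epi (F.map (biprod.inl : N ⟶ N ⊞ K)), ← F.map_comp, ← F.map_comp,
      biprod.inl_desc, biprod.inl_desc]
  have hf : f = biprod.lift f a ≫ biprod.desc (𝟙 N) (0 : K ⟶ N) := by simp [biprod.lift_desc]
  have hg : g = biprod.lift f a ≫ biprod.desc (𝟙 N) b := by simp [biprod.lift_desc, hab]
  rw [hg, F.map_comp, ← hd, ← F.map_comp, ← hf]

namespace IsCompleteHereditaryCotorsionTriple

variable {X Z Y : ObjectProperty A} (h : IsCompleteHereditaryCotorsionTriple X Z Y)

include h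

theorem exists_comp_eq_of_mono {M M' N : A} (hN : Y N) {i : M ⟶ M'}
    (hi : monosWithCokernel Z i) (f : M ⟶ N) : ∃ g : M' ⟶ N, i ≫ g = f := by
  have := hi.1
  exact ExtOneVanishes.exists_extension (shortExact_cokernel i) (h.ext_right hi.2 hN) f

theorem injectiveStable_cancel_mono [EnoughProjectives A] [EnoughInjectives A] {M M' N : A}
    (hN : Y N) {i : M ⟶ M'} (hi : monosWithCokernel Z i) (g g' : M' ⟶ N)
    (hg : injectiveStableSetoid M N (i ≫ g) (i ≫ g')) : injectiveStableSetoid M' N g g' := by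
  have := hi.1
  obtain ⟨I, a, b, hI, hab⟩ := hg
  let a' : M' ⟶ I := Injective.factorThru a i
  have ha' : i ≫ a' = a := Injective.comp_factorThru a i
  -- After correction through `I`, the difference descends to a map from `cokernel i` in `Z` to `N`
  -- in `Y`, which factors through an injective `J`.
  have w : i ≫ (g' - g - a' ≫ b) = 0 := by
    rw [Preadditive.comp_sub, ← Category.assoc, ha', hab, Preadditive.comp_sub, sub_self]
  obtain ⟨J, c, d, hJ, hcd⟩ := h.exists_factor_injective hi.2 hN (cokernel.desc i _ w)
  refine ⟨I ⊞ J, biprod.lift a' (cokernel.π i ≫ c), biprod.desc b d, inferInstance, ?_⟩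
  rw [biprod.lift_desc, Category.assoc, hcd, cokernel.π_desc, add_sub_cancel]

theorem exists_injectiveStable_of_epi [EnoughProjectives A] [EnoughInjectives A] {M M' N : A}
    (hN : Y N) {p : M ⟶ M'} (hp : episWithKernel Z p) (f : M ⟶ N) :
    ∃ g : M' ⟶ N, injectiveStableSetoid M N (p ≫ g) f := by
  obtain ⟨I, e, hI, he⟩ := h.exists_biprod_lift hp
  obtain ⟨g, rfl⟩ := h.exists_comp_eq_of_mono hN he f
  -- The part of the extension on `I` is exactly the error.
  refine ⟨biprod.inl ≫ g, I, e, biprod.inr ≫ g, hI, ?_⟩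
  rw [biprod.lift_eq]
  simp

/-- Cancel the monomorphism `biprod.lift p e` instead, then restrict along `biprod.inl`. -/
theorem injectiveStable_cancel_epi [EnoughProjectives A] [EnoughInjectives A] {M M' N : A}
    (hN : Y N) {p : M ⟶ M'} (hp : episWithKernel Z p) (g g' : M' ⟶ N)
    (hg : injectiveStableSetoid M N (p ≫ g) (p ≫ g')) : injectiveStableSetoid M' N g g' := by
  obtain ⟨I, e, hI, he⟩ := h.exists_biprod_lift hp
  have := injectiveStableSetoid_comp biprod.inl _ _
    (h.injectiveStable_cancel_mono hN he (biprod.fst ≫ g) (biprod.fst ≫ g') (by simpa using hg))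
  simpa using this

theorem exists_comp_eq_of_epi {M N N' : A} (hM : X M) {p : N ⟶ N'}
    (hp : episWithKernel Z p) (f : M ⟶ N') : ∃ g : M ⟶ N, g ≫ p = f := by
  have := hp.1
  exact ExtOneVanishes.exists_lift (shortExact_kernel p) (h.ext_left hM hp.2) f

theorem projectiveStable_cancel_epi [EnoughProjectives A] {M N N' : A}
    (hM : X M) {p : N ⟶ N'} (hp : episWithKernel Z p) (g g' : M ⟶ N)
    (hg : projectiveStableSetoid M N' (g ≫ p) (g' ≫ p)) : projectiveStableSetoid M N g g' := by
  have := hp.1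
  obtain ⟨P, a, b, hP, hab⟩ := hg
  let b' : P ⟶ N := Projective.factorThru b p
  have hb' : b' ≫ p = b := Projective.factorThru_comp b p
  have w : (g' - g - a ≫ b') ≫ p = 0 := by
    rw [Preadditive.sub_comp, Category.assoc, hb', hab, Preadditive.sub_comp, sub_self]
  obtain ⟨J, c, d, hJ, hcd⟩ := h.exists_factor_projective hM hp.2 (kernel.lift p _ w)
  refine ⟨P ⊞ J, biprod.lift a c, biprod.desc b' (d ≫ kernel.ι p), inferInstance, ?_⟩
  rw [biprod.lift_desc, ← Category.assoc, hcd, kernel.lift_ι, add_sub_cancel]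

theorem exists_projectiveStable_of_mono [EnoughProjectives A] {M N N' : A}
    (hM : X M) {i : N ⟶ N'} (hi : monosWithCokernel Z i) (f : M ⟶ N') :
    ∃ g : M ⟶ N, projectiveStableSetoid M N' (g ≫ i) f := by
  obtain ⟨P, s, hP, hs⟩ := h.exists_biprod_desc hi
  obtain ⟨g, rfl⟩ := h.exists_comp_eq_of_epi hM hs f
  refine ⟨g ≫ biprod.fst, P, g ≫ biprod.snd, s, hP, ?_⟩
  rw [biprod.desc_eq]
  simp

theorem projectiveStable_cancel_mono [EnoughProjectives A] {M N N' : A}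
    (hM : X M) {i : N ⟶ N'} (hi : monosWithCokernel Z i) (g g' : M ⟶ N)
    (hg : projectiveStableSetoid M N' (g ≫ i) (g' ≫ i)) : projectiveStableSetoid M N g g' := by
  obtain ⟨P, s, hP, hs⟩ := h.exists_biprod_desc hi
  have := projectiveStableSetoid_comp biprod.fst _ _
    (h.projectiveStable_cancel_epi hM hs (g ≫ biprod.inl) (g' ≫ biprod.inl) (by simpa using hg))
  simpa using this

/-! ### Morphisms in the homotopy category -/

variable {W : MorphismProperty A}
  (mono_mem : ∀ ⦃M N : A⦄ (i : M ⟶ N), monosWithCokernel Z i → W i)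
  (factors : ∀ ⦃M N : A⦄ (w : M ⟶ N), W w → ∃ (E : A) (i : M ⟶ E) (p : E ⟶ N),
    monosWithCokernel Z i ∧ episWithKernel Z p ∧ i ≫ p = w)

include mono_mem factors

theorem exists_equiv_injectiveStable [EnoughProjectives A] [EnoughInjectives A] (M : A) {N : A}
    (hN : Y N) : ∃ e : Quotient (injectiveStableSetoid M N) ≃ (W.Q.obj M ⟶ W.Q.obj N),
      ∀ f : M ⟶ N, e (Quotient.mk _ f) = W.Q.map f := by
  refine exists_equiv_localization_hom_of_precomp W (fun M => injectiveStableSetoid M N)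
    (fun _ _ => injectiveStableSetoid_comp) ?_ ?_ ?_ M
  · intro M M' w hw f
    obtain ⟨E, i, p, hi, hp, rfl⟩ := factors w hw
    obtain ⟨g, rfl⟩ := h.exists_comp_eq_of_mono hN hi f
    obtain ⟨g', hg'⟩ := h.exists_injectiveStable_of_epi hN hp g
    refine ⟨g', ?_⟩
    rw [Category.assoc]
    exact injectiveStableSetoid_comp i _ _ hg'
  · intro M M' w hw g g' hg
    obtain ⟨E, i, p, hi, hp, rfl⟩ := factors w hw
    rw [Category.assoc, Category.assoc] at hg
    exact h.injectiveStable_cancel_epi hN hp _ _ (h.injectiveStable_cancel_mono hN hi _ _ hg)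
  · rintro M g g' ⟨I, a, b, hI, hab⟩
    -- Injectives lie in `Z`, so `N ⟶ N ⊞ I` is in `W`.
    exact map_eq_of_sub_factors W.Q (Localization.inverts W.Q W _
      (mono_mem _ (h.monosWithCokernel_inl N (h.mem_of_injective I)))) a b hab

theorem exists_equiv_projectiveStable [EnoughProjectives A] {M : A} (hM : X M) (N : A) :
    ∃ e : Quotient (projectiveStableSetoid M N) ≃ (W.Q.obj M ⟶ W.Q.obj N),
      ∀ f : M ⟶ N, e (Quotient.mk _ f) = W.Q.map f := by
  refine exists_equiv_localization_hom_of_postcomp W (fun N => projectiveStableSetoid M N)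
    (fun _ _ => projectiveStableSetoid_comp) ?_ ?_ ?_ N
  · intro N N' w hw f
    obtain ⟨E, i, p, hi, hp, rfl⟩ := factors w hw
    obtain ⟨g, rfl⟩ := h.exists_comp_eq_of_epi hM hp f
    obtain ⟨g', hg'⟩ := h.exists_projectiveStable_of_mono hM hi g
    refine ⟨g', ?_⟩
    rw [← Category.assoc]
    exact projectiveStableSetoid_comp p _ _ hg'
  · intro N N' w hw g g' hg
    obtain ⟨E, i, p, hi, hp, rfl⟩ := factors w hw
    rw [← Category.assoc, ← Category.assoc] at hg
    exact h.projectiveStable_cancel_mono hM hi _ _ (h.projectiveStable_cancel_epi hM hp _ _ hg)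
  · rintro N g g' ⟨P, a, b, hP, hab⟩
    exact map_eq_of_sub_factors W.Q (Localization.inverts W.Q W _
      (mono_mem _ (h.monosWithCokernel_inl N (h.mem_of_projective P)))) a b hab

end IsCompleteHereditaryCotorsionTriple

end CotorsionTriple


/-- `W` ranges over the weak equivalences of the projective and of the injective model structure, and
`W.Q : A ⥤ W.Localization` is the canonical functor to the homotopy category obtained by formally
inverting `W`. Both descriptions of `Hom_{Ho(A)}(M, N)` hold for both homotopy categories; the bijections
are the canonical ones, `[f] ↦ (W.Q.map i)⁻¹ ∘ W.Q.map f` and `[f] ↦ W.Q.map f ∘ (W.Q.map p)⁻¹`. -/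
theorem proposition3p3 {A : Type u} [Category.{v} A] [Abelian A]
    [EnoughProjectives A] [EnoughInjectives A] [HasLimits A] [HasColimits A]
    (X Z Y : ObjectProperty A)
    (h : CotorsionTriple.IsCompleteHereditaryCotorsionTriple X Z Y)
    (W : MorphismProperty A)
    (hW : W = CotorsionTriple.projectiveWeakEquivalences X Z ∨
      W = CotorsionTriple.injectiveWeakEquivalences Z Y)
    (M N : A) :
    (∀ (YN : A) (i : N ⟶ YN), CotorsionTriple.IsSpecialLeftApproximation Y i →
      IsIso (W.Q.map i) ∧
      ∃ e : Quotient (CotorsionTriple.injectiveStableSetoid M YN) ≃ (W.Q.obj M ⟶ W.Q.obj N),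
        ∀ f : M ⟶ YN, e (Quotient.mk _ f) ≫ W.Q.map i = W.Q.map f) ∧
    (∀ (XM : A) (p : XM ⟶ M), CotorsionTriple.IsSpecialRightApproximation X p →
      IsIso (W.Q.map p) ∧
      ∃ e : Quotient (CotorsionTriple.projectiveStableSetoid XM N) ≃ (W.Q.obj M ⟶ W.Q.obj N),
        ∀ f : XM ⟶ N, W.Q.map p ≫ e (Quotient.mk _ f) = W.Q.map f) := by
  have mono_mem : ∀ ⦃M N : A⦄ (i : M ⟶ N), CotorsionTriple.monosWithCokernel Z i → W i := by
    rcases hW with rfl | rfl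
    · exact fun _ _ _ => h.projectiveWeakEquivalences_of_mono
    · exact fun _ _ _ => h.injectiveWeakEquivalences_of_mono
  have epi_mem : ∀ ⦃M N : A⦄ (p : M ⟶ N), CotorsionTriple.episWithKernel Z p → W p := by
    rcases hW with rfl | rfl
    · exact fun _ _ _ => h.projectiveWeakEquivalences_of_epi
    · exact fun _ _ _ => h.injectiveWeakEquivalences_of_epi
  have factors : ∀ ⦃M N : A⦄ (w : M ⟶ N), W w → ∃ (E : A) (i : M ⟶ E) (p : E ⟶ N),
      CotorsionTriple.monosWithCokernel Z i ∧ CotorsionTriple.episWithKernel Z p ∧ i ≫ p = w := by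
    rcases hW with rfl | rfl
    all_goals exact fun _ _ _ => CotorsionTriple.exists_monosWithCokernel_of_weakEquivalences
  refine ⟨fun YN i hi => ?_, fun XM p hp => ?_⟩
  · have : IsIso (W.Q.map i) := by
      refine Localization.inverts W.Q W i (mono_mem i ⟨hi.mono, ?_⟩)
      rw [h.pair_right.left_eq]
      exact hi.cokernel_mem
    obtain ⟨e, he⟩ := h.exists_equiv_injectiveStable mono_mem factors M hi.mem
    -- The bijection for maps into `YN`, transported along the inverse of `W.Q.map i`.
    refine ⟨this, e.trans ((asIso (W.Q.map i)).symm.homToEquiv), fun f => ?_⟩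
    simp [he]
  · have : IsIso (W.Q.map p) := by
      refine Localization.inverts W.Q W p (epi_mem p ⟨hp.epi, ?_⟩)
      rw [h.pair_left.right_eq]
      exact hp.kernel_mem
    obtain ⟨e, he⟩ := h.exists_equiv_projectiveStable mono_mem factors hp.mem N
    refine ⟨this, e.trans ((asIso (W.Q.map p)).homFromEquiv), fun f => ?_⟩
    simp [he]
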